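/- Let $\Omega=C_0(\mathbb R_+)$ be the space of continuous paths $\omega:[0,\infty)\to\mathbb R$ with $\omega_0=0$, with the topology of uniform convergence on compact intervals and its Borel $\sigma$-algebra $\mathcal B(\Omega)$. Let $G:\mathbb R\to\mathbb R$ be monotone and sublinear, let $\hat{\mathbb E}$ be a $G$-expectation, i.e. a sublinear expectation on a space of random variables on $\Omega$ containing the bounded continuous functions $C_b(\Omega)$ under which the canonical process $B_t(\omega)=\omega_t$ is a $G$-Brownian motion, and let $\mathcal P$ be a weakly compact family of probability measures on $(\Omega,\mathcal B(\Omega))$ with $\hat{\mathbb E}[X]=\sup_{P\in\mathcal P}E_P[X]$ for all $X\in C_b(\Omega)$. For measurable $X\ge 0$ on $\Omega$ put $\hat{\mathbb E}[X]:=\sup_{P\in\mathcal P}E_P[X]\in[0,\infty]$. For $T>0$ let $M_{b,0}(0,T)$ be the set of processes $\eta_t(\omega)=\sum_{j=0}^{N-1}\xi_j(\omega)\mathbf 1_{[t_j,t_{j+1})}(t)$ with $N\ge1$, $0=t_0<\dots<t_N=T$, and $\xi_j$ bounded and measurable with respect to $\mathcal F_{t_j}=\mathcal B(\Omega_{t_j})$,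 where $\Omega_t=\{\omega_{\cdot\wedge t}:\omega\in\Omega\}$ (functions on $\Omega_t$ are viewed as functions on $\Omega$ through $\omega\mapsto\omega_{\cdot\wedge t}$). For $p\ge1$ let $M_*^p(0,T)$ be the completion of $M_{b,0}(0,T)$ under the norm $\|\eta\|_{M^p(0,T)}=\big(\hat{\mathbb E}\int_0^T|\eta_t|^p\,dt\big)^{1/p}$, realized as the space of jointly measurable processes $X$ for which there are $Y^{(k)}\in M_{b,0}(0,T)$ with $\|X-Y^{(k)}\|_{M^p(0,T)}\to0$. Then for every $p\ge 1$ and every $X\in M_*^p(0,T)$, $$\lim_{n\to\infty}\hat{\mathbb E}\left[\int_0^T|X_t|^p\,\mathbf 1_{\{|X_t|>n\}}\,dt\right]=0 .$$ -/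

import Mathlib

open MeasureTheory Filter Topology Set
open scoped NNReal ENNReal BoundedContinuousFunction

noncomputable section

namespace GExp

/-! ### Sublinear expectations and `G`-Brownian motion (dimension one) -/

/-- Bounded and Lipschitz continuous real functions: the class `C_{b,Lip}`. -/
def IsCbLip {α : Type*} [PseudoMetricSpace α] (φ : α → ℝ) : Prop :=
  (∃ K : ℝ≥0, LipschitzWith K φ) ∧ ∃ C : ℝ, ∀ x, |φ x| ≤ C

/-- A sublinear expectation space `(Ω, H, E)`.  The functional `E` is only meaningful on the
linear space `H` of random variables. -/
structure SublinearExpectation (Ω : Type) where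
  /-- the space of random variables -/
  H : Submodule ℝ (Ω → ℝ)
  /-- the sublinear expectation -/
  E : (Ω → ℝ) → ℝ
  const_mem : ∀ c : ℝ, (fun _ => c) ∈ H
  abs_mem : ∀ X ∈ H, (fun ω => |X ω|) ∈ H
  comp_mem : ∀ (d : ℕ) (X : Fin d → Ω → ℝ), (∀ i, X i ∈ H) →
    ∀ φ : (Fin d → ℝ) → ℝ, IsCbLip φ → (fun ω => φ (fun i => X i ω)) ∈ H
  mono : ∀ X ∈ H, ∀ Y ∈ H, (∀ ω, Y ω ≤ X ω) → E Y ≤ E X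
  const_preserving : ∀ c : ℝ, E (fun _ => c) = c
  sub_additive : ∀ X ∈ H, ∀ Y ∈ H, E X - E Y ≤ E (X - Y)
  pos_homogeneous : ∀ X ∈ H, ∀ r : ℝ, 0 ≤ r → E (r • X) = r * E X

/-- The random variable `X` is independent from the random vector `Y = (Y₁, …, Yₙ)`:
`E[φ(X, Y)] = E[ E[φ(X, y)]_{y = Y} ]` for all `φ ∈ C_{b,Lip}(ℝ × ℝⁿ)`. -/
def IndepFrom {Ω : Type} (S : SublinearExpectation Ω) (X : Ω → ℝ) {n : ℕ}
    (Y : Fin n → Ω → ℝ) : Prop :=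
  ∀ φ : ℝ × (Fin n → ℝ) → ℝ, IsCbLip φ →
    S.E (fun ω => φ (X ω, fun i => Y i ω)) =
      S.E (fun ω => S.E (fun ω' => φ (X ω', fun i => Y i ω)))

/-- The random variables `X₁`, `X₂`, possibly on different spaces, are identically
distributed. -/
def IdentDist {Ω₁ Ω₂ : Type} (S₁ : SublinearExpectation Ω₁) (X₁ : Ω₁ → ℝ)
    (S₂ : SublinearExpectation Ω₂) (X₂ : Ω₂ → ℝ) : Prop :=
  ∀ φ : ℝ → ℝ, IsCbLip φ → S₁.E (fun ω => φ (X₁ ω)) = S₂.E (fun ω => φ (X₂ ω))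

/-- `X` is `G`-normal distributed: `aX + bX'` has the distribution of `√(a² + b²) X`, with `X'` an
independent copy of `X`, and `G(a) = E[a X²] / 2`. -/
def IsGNormal {Ω : Type} (S : SublinearExpectation Ω) (G : ℝ → ℝ) (X : Ω → ℝ) : Prop :=
  X ∈ S.H ∧ (fun ω => X ω ^ 2) ∈ S.H ∧
  (∀ a : ℝ, G a = 1 / 2 * S.E (fun ω => a * X ω ^ 2)) ∧
  ∃ X' ∈ S.H, IdentDist S X' S X ∧ IndepFrom S X' (fun _ : Fin 1 => X) ∧
    ∀ a b : ℝ, 0 ≤ a → 0 ≤ b →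
      IdentDist S (fun ω => a * X ω + b * X' ω) S (fun ω => √(a ^ 2 + b ^ 2) * X ω)

/-- `B` is a `G`-Brownian motion on the sublinear expectation space `(Ω, H, E)`. -/
structure IsGBrownianMotion {Ω : Type} (S : SublinearExpectation Ω) (G : ℝ → ℝ)
    (B : ℝ≥0 → Ω → ℝ) : Prop where
  mem : ∀ t, B t ∈ S.H
  zero : ∀ ω, B 0 ω = 0
  indep : ∀ (t s : ℝ≥0) (n : ℕ) (u : Fin n → ℝ≥0), Monotone u → (∀ i, u i ≤ t) →
    IndepFrom S (fun ω => B (t + s) ω - B t ω) (fun i => B (u i))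
  normal : ∃ (Ω' : Type) (S' : SublinearExpectation Ω') (X : Ω' → ℝ), IsGNormal S' G X ∧
    ∀ t s : ℝ≥0, IdentDist S (fun ω => B (t + s) ω - B t ω) S' (fun ω' => √(s : ℝ) * X ω')

/-! ### Path space -/

/-- `Ω = C₀(ℝ₊)`: real continuous paths on `[0, ∞)` started at `0`. -/
def PathSpace : Type := {ω : C(ℝ≥0, ℝ) // ω 0 = 0}

/-- The topology of uniform convergence on compact time intervals (the compact-open topology),
i.e. the one of `ρ(ω, ω') = ∑ i ≥ 1, 2⁻ⁱ (max_{t ≤ i} |ω t - ω' t| ∧ 1)`. -/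
instance : TopologicalSpace PathSpace :=
  inferInstanceAs (TopologicalSpace {ω : C(ℝ≥0, ℝ) // ω 0 = 0})

instance : MeasurableSpace PathSpace := borel PathSpace

instance : BorelSpace PathSpace := ⟨rfl⟩

/-- The canonical process `B_t(ω) = ω_t`. -/
def canonicalProcess (t : ℝ≥0) (ω : PathSpace) : ℝ := ω.1 t

/-- The stopped path `ω_{· ∧ t}`; the range of `stopPath t` is `Ω_t`. -/
def stopPath (t : ℝ≥0) (ω : PathSpace) : PathSpace :=
  ⟨ω.1.comp ⟨fun s => min s t, by fun_prop⟩, by simpa using ω.2⟩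

/-- `𝓕_t = 𝓑(Ω_t)`, as a σ-algebra on `Ω` through the map `ω ↦ ω_{· ∧ t}` from `Ω` onto `Ω_t`. -/
@[reducible] def sigmaAlg (t : ℝ≥0) : MeasurableSpace PathSpace :=
  MeasurableSpace.comap (stopPath t) inferInstance

/-- `B_b(Ω_t)`: bounded `𝓑(Ω_t)`-measurable real functions. -/
def Bb (t : ℝ≥0) : Set (PathSpace → ℝ) :=
  {ξ | Measurable[sigmaAlg t] ξ ∧ ∃ C : ℝ, ∀ ω, |ξ ω| ≤ C}

/-! ### The `G`-expectation and its representing family -/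

/-- `G` is a monotone sublinear function, `S` is a sublinear expectation on a space of random
variables on `Ω = C₀(ℝ₊)` containing `C_b(Ω)`, under which the canonical process is a `G`-Brownian
motion (so `S.E` is the `G`-expectation), and `Ps` is a weakly compact family of probability
measures which represents it: `S.E X = sup_{P ∈ Ps} E_P[X]` for `X ∈ C_b(Ω)`. -/
structure IsGSetting (G : ℝ → ℝ) (S : SublinearExpectation PathSpace)
    (Ps : Set (ProbabilityMeasure PathSpace)) : Prop where
  G_mono : Monotone G
  G_subadditive : ∀ a b : ℝ, G (a + b) ≤ G a + G b
  G_pos_homogeneous : ∀ r a : ℝ, 0 ≤ r → G (r * a) = r * G a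
  bcf_mem : ∀ X : PathSpace →ᵇ ℝ, (fun ω => X ω) ∈ S.H
  canonical : IsGBrownianMotion S G canonicalProcess
  weakly_compact : IsCompact Ps
  representation : ∀ X : PathSpace →ᵇ ℝ,
    IsLUB ((fun P : ProbabilityMeasure PathSpace => ∫ ω, X ω ∂(P : Measure PathSpace)) '' Ps)
      (S.E fun ω => X ω)

/-- The extension `Ê[Z] = sup_{P ∈ Ps} E_P[Z]` to nonnegative random variables `Z`, with values
in `[0, ∞]`. -/
def upperExp (Ps : Set (ProbabilityMeasure PathSpace)) (Z : PathSpace → ℝ≥0∞) : ℝ≥0∞ :=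
  ⨆ P ∈ Ps, ∫⁻ ω, Z ω ∂(P : Measure PathSpace)

/-- `Ê[∫_0^T f(η_t) dt]` for a process `η` and a function `f ≥ 0`. -/
def upperExpInt (Ps : Set (ProbabilityMeasure PathSpace)) (T : ℝ≥0) (f : ℝ → ℝ)
    (η : ℝ≥0 → PathSpace → ℝ) : ℝ≥0∞ :=
  upperExp Ps fun ω => ∫⁻ t in Icc (0 : ℝ) (T : ℝ), ENNReal.ofReal (f (η t.toNNReal ω))

/-! ### The spaces of integrands -/

/-- The simple processes `M_{b,0}(0,T)`:
`η_t(ω) = ∑_{j < N} ξ_j(ω) 1_{[t_j, t_{j+1})}(t)` with `0 = t_0 < ⋯ < t_N = T` and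
`ξ_j ∈ B_b(Ω_{t_j})`. -/
def simpleProcesses (T : ℝ≥0) : Set (ℝ≥0 → PathSpace → ℝ) :=
  {η | ∃ (N : ℕ) (τ : ℕ → ℝ≥0) (ξ : ℕ → PathSpace → ℝ),
    0 < N ∧ τ 0 = 0 ∧ τ N = T ∧ (∀ j < N, τ j < τ (j + 1)) ∧ (∀ j < N, ξ j ∈ Bb (τ j)) ∧
    ∀ t ω, η t ω = ∑ j ∈ Finset.range N, (Ico (τ j) (τ (j + 1))).indicator (fun _ => ξ j ω) t}

/-- The norm `‖η‖ = (Ê[∫_0^T |η_t|^p dt])^{1/p}`, with values in `[0, ∞]`. -/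
def normM (Ps : Set (ProbabilityMeasure PathSpace)) (p : ℝ) (T : ℝ≥0)
    (η : ℝ≥0 → PathSpace → ℝ) : ℝ≥0∞ :=
  (upperExpInt Ps T (fun x => |x| ^ p) η) ^ (1 / p)

/-- The space `M_*^p(0,T)`, the completion of `M_{b,0}(0,T)` under `normM`, realized by processes:
the jointly measurable processes which are limits in this norm of simple processes.  A Cauchy
sequence of simple processes has a subsequence converging `P ⊗ dt`-a.e. for every `P ∈ Ps`, outside
one common measurable set, so this is the completion (no distinction being made between classes and
their representatives). Only the values of a process on the time interval `[0,T]` matter. -/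
def MStar (Ps : Set (ProbabilityMeasure PathSpace)) (p : ℝ) (T : ℝ≥0) :
    Set (ℝ≥0 → PathSpace → ℝ) :=
  {X | Measurable (Function.uncurry X) ∧
    ∃ Y : ℕ → ℝ≥0 → PathSpace → ℝ, (∀ k, Y k ∈ simpleProcesses T) ∧
      Tendsto (fun k => normM Ps p T (X - Y k)) atTop (𝓝 0)}

end GExp

end

namespace GExp

/-! Downward monotone or dominated convergence can fail for a supremum over `Ps`, so the tail is
controlled by approximation. Let `Y` be simple with `|Y| ≤ C`, and let `n ≥ 2C`. Where `|X| > n`,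
`|Y| ≤ n/2 < |X|/2`, hence `|X| ≤ 2|X - Y|`. Thus `|X|^p 1_{|X|>n} ≤ 2^p |X - Y|^p` everywhere
(`indicator_abs_rpow_le`), and applying `Ê` bounds the tail by `2^p ‖X - Y‖^p` for all such `n`.
Density of simple processes makes this small. -/

theorem simpleProcesses_bounded {T : ℝ≥0} {Y : ℝ≥0 → PathSpace → ℝ}
    (hY : Y ∈ simpleProcesses T) : ∃ C : ℝ, ∀ t ω, |Y t ω| ≤ C := by
  obtain ⟨N, τ, ξ, -, -, -, -, hξ, hYeq⟩ := hY
  -- Nonnegativity covers the summands whose indicator vanishes at `t`.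
  have hbd : ∀ j, ∃ C : ℝ, 0 ≤ C ∧ (j < N → ∀ ω, |ξ j ω| ≤ C) := by
    intro j
    by_cases hj : j < N
    · obtain ⟨-, C, hC⟩ := hξ j hj
      exact ⟨|C|, abs_nonneg C, fun _ ω => (hC ω).trans (le_abs_self C)⟩
    · exact ⟨0, le_rfl, fun h => absurd h hj⟩
  choose C hC0 hC using hbd
  refine ⟨∑ j ∈ Finset.range N, C j, fun t ω => ?_⟩
  rw [hYeq]
  refine (Finset.abs_sum_le_sum_abs _ _).trans (Finset.sum_le_sum fun j hj => ?_)
  by_cases ht : t ∈ Ico (τ j) (τ (j + 1))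
  · simpa [indicator_of_mem ht] using hC j (Finset.mem_range.mp hj) ω
  · simpa [indicator_of_notMem ht] using hC0 j

/-- A pointwise bound `f (X_t) ≤ c g (Y_t)` passes to `Ê[∫_0^T · dt]`. -/
theorem upperExpInt_le_const_mul (Ps : Set (ProbabilityMeasure PathSpace)) (T : ℝ≥0)
    {f g : ℝ → ℝ} {X Y : ℝ≥0 → PathSpace → ℝ} {c : ℝ} (hc : 0 ≤ c)
    (h : ∀ t ω, f (X t ω) ≤ c * g (Y t ω)) :
    upperExpInt Ps T f X ≤ ENNReal.ofReal c * upperExpInt Ps T g Y := by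
  refine iSup₂_le fun P hP => ?_
  calc ∫⁻ ω, (∫⁻ t in Icc (0 : ℝ) T, ENNReal.ofReal (f (X t.toNNReal ω))) ∂(P : Measure PathSpace)
      ≤ ∫⁻ ω, ENNReal.ofReal c * (∫⁻ t in Icc (0 : ℝ) T, ENNReal.ofReal (g (Y t.toNNReal ω)))
          ∂(P : Measure PathSpace) := by
        refine lintegral_mono fun ω => ?_
        -- The primed version trades measurability of the integrand for finiteness of the constant.
        rw [← lintegral_const_mul' _ _ ENNReal.ofReal_ne_top]
        refine lintegral_mono fun t => ?_
        rw [← ENNReal.ofReal_mul hc]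
        exact ENNReal.ofReal_le_ofReal (h _ _)
    _ = ENNReal.ofReal c * ∫⁻ ω, (∫⁻ t in Icc (0 : ℝ) T, ENNReal.ofReal (g (Y t.toNNReal ω)))
          ∂(P : Measure PathSpace) := lintegral_const_mul' _ _ ENNReal.ofReal_ne_top
    _ ≤ ENNReal.ofReal c * upperExpInt Ps T g Y :=
        mul_le_mul_right (le_iSup₂ (f := fun (Q : ProbabilityMeasure PathSpace) (_ : Q ∈ Ps) =>
          ∫⁻ ω, (∫⁻ t in Icc (0 : ℝ) T, ENNReal.ofReal (g (Y t.toNNReal ω)))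
            ∂(Q : Measure PathSpace)) P hP) _

theorem normM_rpow (Ps : Set (ProbabilityMeasure PathSpace)) {p : ℝ} (hp : p ≠ 0) (T : ℝ≥0)
    (η : ℝ≥0 → PathSpace → ℝ) :
    normM Ps p T η ^ p = upperExpInt Ps T (fun x => |x| ^ p) η := by
  rw [normM, ← ENNReal.rpow_mul, one_div_mul_cancel hp, ENNReal.rpow_one]

/-- If `|x| > n`, then `2|x - y| ≥ 2|x| - 2C ≥ 2|x| - n > |x|`; otherwise the left side is `0`. -/
theorem indicator_abs_rpow_le {p n C x y : ℝ} (hp : 0 ≤ p) (hn : 2 * C ≤ n) (hy : |y| ≤ C) :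
    {z : ℝ | n < |z|}.indicator (fun z => |z| ^ p) x ≤ 2 ^ p * |x - y| ^ p := by
  refine indicator_apply_le' (fun hx => ?_) (fun _ => by positivity)
  rw [← Real.mul_rpow zero_le_two (abs_nonneg _)]
  refine Real.rpow_le_rpow (abs_nonneg x) ?_ hp
  have hx : n < |x| := hx
  linarith [abs_sub_abs_le_abs_sub x y]

end GExp

theorem mainTheorem8 (G : ℝ → ℝ) (S : GExp.SublinearExpectation GExp.PathSpace)
    (Ps : Set (ProbabilityMeasure GExp.PathSpace)) (hG : GExp.IsGSetting G S Ps)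
    (T : ℝ≥0) (hT : 0 < T) (p : ℝ) (hp : 1 ≤ p)
    (X : ℝ≥0 → GExp.PathSpace → ℝ) (hX : X ∈ GExp.MStar Ps p T) :
    Tendsto (fun n : ℕ =>
        GExp.upperExpInt Ps T (fun x => {y : ℝ | (n : ℝ) < |y|}.indicator (fun y => |y| ^ p) x) X)
      atTop (𝓝 0) := by
  obtain ⟨-, Y, hY, hlim⟩ := hX
  have hp0 : 0 < p := one_pos.trans_le hp
  have hlim' : Tendsto (fun k => ENNReal.ofReal (2 ^ p) * GExp.normM Ps p T (X - Y k) ^ p)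
      atTop (𝓝 0) := by
    have h := ENNReal.Tendsto.const_mul (a := ENNReal.ofReal (2 ^ p))
      (hlim.ennrpow_const p) (Or.inr ENNReal.ofReal_ne_top)
    simpa [ENNReal.zero_rpow_of_pos hp0] using h
  rw [ENNReal.tendsto_nhds_zero] at hlim' ⊢
  intro ε hε
  -- A single approximant suffices: its bound `C` fixes the threshold `2C` for `n`.
  obtain ⟨k, hk⟩ := (hlim' ε hε).exists
  obtain ⟨C, hC⟩ := GExp.simpleProcesses_bounded (hY k)
  filter_upwards [eventually_ge_atTop ⌈2 * C⌉₊] with n hn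
  refine le_trans ?_ hk
  rw [GExp.normM_rpow Ps hp0.ne']
  exact GExp.upperExpInt_le_const_mul Ps T (by positivity) fun t ω =>
    GExp.indicator_abs_rpow_le hp0.le (Nat.ceil_le.mp hn) (hC t ω)
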